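/- For $n\ge 0$ let $L_n$ be the $n$-th Legendre polynomial, $L_n(x)=\frac{1}{2^n n!}\frac{d^n}{dx^n}(x^2-1)^n$, and let $P_n(\omega)=\sqrt{2n+1}\,L_n(\omega/\pi)$, so that $\frac1{2\pi}\int_{-\pi}^{\pi}P_n(\omega)P_m(\omega)\,d\omega=\delta_{mn}$. Let $K^n=(-i)^nP_n\!\left(i\,\frac{d}{dt}\right)$ be the $n$-th Legendre chromatic derivative, that is, the linear differential operator obtained by replacing each power $\omega^k$ in $(-i)^nP_n(\omega)$ by $i^k\,\frac{d^k}{dt^k}$; its coefficients are real because $P_n$ contains only powers of the same parity as $n$. Let $BL(\pi)$ be the space of continuous $L^2$ functions on $\mathbb R$ whose Fourier transform $\widehat f(\omega)=\int_{-\infty}^{\infty} f(t)e^{-i\omega t}\,dt$ (in the sense of $L^2$) is supported in $[-\pi,\pi]$. Let $f:\mathbb R\to\mathbb R$ be the restriction to $\mathbb R$ of an entire function. Then the following are equivalent: (a) $\sum_{n=0}^{\infty}K^n[f](0)^2<\infty$; (b) for all $t\in\mathbb R$ the sum $\sum_{n=0}^{\infty}K^n[f](t)^2$ converges, and its value is independent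 of $t\in\mathbb R$; (c) $f\in BL(\pi)$. -/

import Mathlib

open scoped FourierTransform

noncomputable section

/-- The Legendre polynomial `L_n(x) = 1 / (2 ^ n n!) (d/dx)^n (x ^ 2 - 1) ^ n`. -/
def legendre (n : ℕ) : Polynomial ℝ :=
  Polynomial.C (1 / (2 ^ n * (n.factorial : ℝ))) *
    Polynomial.derivative^[n] ((Polynomial.X ^ 2 - 1) ^ n)

/-- The rescaled Legendre polynomial `P_n(ω) = √(2 n + 1) L_n(ω / π)`, orthonormal on `[-π, π]`
with respect to `dω / (2 π)`. -/
def legendreP (n : ℕ) : Polynomial ℝ :=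
  Polynomial.C (Real.sqrt (2 * n + 1)) *
    (legendre n).comp (Polynomial.C (1 / Real.pi) * Polynomial.X)

/-- The value at `t` of `(-i)^n P_n(i d/dt) f`: each power `ω ^ k` in `P_n(ω)` is replaced with
`i ^ k d ^ k / dt ^ k`. This is a real number when `f` is real, but it is written here with complex
coefficients. -/
def chromaticDerivC (n : ℕ) (f : ℝ → ℝ) (t : ℝ) : ℂ :=
  (-Complex.I) ^ n *
    (legendreP n).sum fun k c => (c : ℂ) * Complex.I ^ k * ((iteratedDeriv k f t : ℝ) : ℂ)

/-- The Legendre chromatic derivative `K^n[f](t)` of a real function, as a real number; see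
`ofReal_chromaticDeriv`. -/
def chromaticDeriv (n : ℕ) (f : ℝ → ℝ) (t : ℝ) : ℝ := (chromaticDerivC n f t).re

/-- Only powers of the parity of `n` occur in `P_n`. -/
theorem legendreP_coeff_eq_zero (n k : ℕ) (h : Odd (n + k)) : (legendreP n).coeff k = 0 := by
  have hex : ((Polynomial.X ^ 2 - 1) ^ n : Polynomial ℝ) =
      Polynomial.expand ℝ 2 ((Polynomial.X - 1) ^ n) := by simp
  have h2 : ¬ 2 ∣ k + n := by
    rw [← even_iff_two_dvd, Nat.not_even_iff_odd, add_comm]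
    exact h
  have h0 : (legendre n).coeff k = 0 := by
    rw [legendre, Polynomial.coeff_C_mul, Polynomial.coeff_iterate_derivative, hex,
      Polynomial.coeff_expand (by norm_num), if_neg h2]
    simp
  rw [legendreP, Polynomial.coeff_C_mul, Polynomial.comp_C_mul_X_coeff, h0]
  simp

/-- The operator `K^n` has real coefficients: taking the real part changes nothing. -/
theorem ofReal_chromaticDeriv (n : ℕ) (f : ℝ → ℝ) (t : ℝ) :
    (chromaticDeriv n f t : ℂ) = chromaticDerivC n f t := by
  rw [chromaticDeriv, ← Complex.conj_eq_iff_re, chromaticDerivC, Polynomial.sum, Finset.mul_sum,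
    map_sum]
  refine Finset.sum_congr rfl fun k _ => ?_
  rcases Nat.even_or_odd (n + k) with h | h
  · have h1 : ((-1 : ℂ)) ^ n * (-1) ^ k = 1 := by rw [← pow_add, h.neg_one_pow]
    simp only [map_mul, map_pow, map_neg, Complex.conj_I, Complex.conj_ofReal, neg_neg]
    rw [neg_pow Complex.I n, neg_pow Complex.I k]
    have h2 : ((-1 : ℂ)) ^ n = (-1) ^ k := by
      rcases Nat.even_or_odd k with hk | hk
      · rw [hk.neg_one_pow, (Nat.even_add.mp h |>.mpr hk).neg_one_pow]
      · have hn : Odd n := by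
          rw [← Nat.not_even_iff_odd] at hk ⊢
          exact fun hn => hk (Nat.even_add.mp h |>.mp hn)
        rw [hk.neg_one_pow, hn.neg_one_pow]
    rw [h2]
    ring
  · rw [legendreP_coeff_eq_zero n k h]
    simp

/-- The real signals of finite energy in `BL(σ)`: continuous square integrable functions whose
(Plancherel) Fourier transform vanishes almost everywhere outside the band `[-σ, σ]`.
Mathlib's `𝓕 f ξ` is `∫ f(x) exp(-2 π i x ξ) dx`, so the angular frequency is `ω = 2 π ξ`. -/
def BL (σ : ℝ) : Set (ℝ → ℝ) :=
  {f | Continuous f ∧ ∃ hf : MeasureTheory.MemLp (fun x => (f x : ℂ)) 2 MeasureTheory.volume,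
    ∀ᵐ ξ : ℝ, 2 * Real.pi * ξ ∉ Set.Icc (-σ) σ →
      (𝓕 (hf.toLp (fun x => (f x : ℂ))) : MeasureTheory.Lp ℂ 2 MeasureTheory.volume) ξ = 0}

end

/-!
A signal `f ∈ BL(π)` is the inverse Fourier integral of a square integrable spectrum `G` supported
in the band `|ω| ≤ π`. On the frequency side `K^n` is multiplication by `(-i)^n P_n(-ω)`, so
`K^n[f](t)` is the inner product, for the measure `dω / (2 π)`, of `exp(i ω t) G(ω)` with the
chromatic mode `i^n P_n(-ω)`. The chromatic modes form a Hilbert basis of `L²` of the band, so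
Parseval's identity gives `∑ K^n[f](t)^2 = ‖exp(i ω t) G‖^2 = ‖G‖^2`, which does not depend on `t`
(`hasSum_norm_sq_derivFunctional`).

Conversely, if `∑ K^n[f](0)^2 < ∞`, the numbers `K^n[f](0)` are the coordinates of some spectrum `G`
in that basis. The signal `φ` with spectrum `G` has the same chromatic derivatives at `0` as `f`.
As `P_n` has degree `n`, it has the same ordinary derivatives there too
(`eq_of_derivFunctional_legendreP_eq`). Both functions are sums of their Taylor series, so `f = φ`
(`exists_eq_bandSynthesis_of_summable`).

Orthonormality of the modes is Rodrigues' formula and integration by parts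
(`integral_legendreP_mul_legendreP`). Completeness follows from the same Taylor series argument: if
`G` is orthogonal to all modes, all derivatives of its signal vanish at `0`, so the signal is zero,
and `G = 0` by Plancherel (`span_chromaticModeLp_orthogonal`).

Frequencies are measured by `ξ = ω / (2 π)`, as in Mathlib's Fourier transform, so the band is
`[-1/2, 1/2]`, of length one.
-/

noncomputable section

open MeasureTheory Polynomial

/-! ### Legendre polynomials -/

theorem integral_mul_derivative_eq_neg (p q : ℝ[X]) (h1 : p.eval 1 = 0) (h2 : p.eval (-1) = 0) :
    ∫ x in (-1 : ℝ)..1, q.eval x * (derivative p).eval x =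
      -∫ x in (-1 : ℝ)..1, (derivative q).eval x * p.eval x := by
  rw [intervalIntegral.integral_mul_deriv_eq_deriv_mul (u := fun x => q.eval x)
    (v := fun x => p.eval x) (u' := fun x => (derivative q).eval x)
    (fun x _ => q.hasDerivAt x) (fun x _ => p.hasDerivAt x)
    ((derivative q).continuous.intervalIntegrable _ _)
    ((derivative p).continuous.intervalIntegrable _ _), h1, h2]
  ring

theorem eval_iterate_derivative_sq_sub_one_pow {n j : ℕ} (h : j < n) {x : ℝ} (hx : x ^ 2 = 1) :
    (derivative^[j] ((X ^ 2 - 1 : ℝ[X]) ^ n)).eval x = 0 := by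
  obtain ⟨r, hr⟩ := pow_sub_dvd_iterate_derivative_pow (X ^ 2 - 1 : ℝ[X]) n j
  rw [hr]
  simp [hx, Nat.sub_ne_zero_of_lt h]

/-- Integration by parts `j` times; no boundary terms appear because `(x ^ 2 - 1) ^ n` vanishes to
order `n` at both endpoints. -/
theorem integral_mul_iterate_derivative_sq_sub_one_pow (n : ℕ) {j : ℕ} (hj : j ≤ n) (q : ℝ[X]) :
    ∫ x in (-1 : ℝ)..1, q.eval x * (derivative^[j] ((X ^ 2 - 1 : ℝ[X]) ^ n)).eval x =
      (-1) ^ j * ∫ x in (-1 : ℝ)..1, (derivative^[j] q).eval x * (x ^ 2 - 1) ^ n := by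
  induction j generalizing q with
  | zero => simp
  | succ j ih =>
    rw [Function.iterate_succ_apply', integral_mul_derivative_eq_neg _ _
      (eval_iterate_derivative_sq_sub_one_pow hj (by norm_num))
      (eval_iterate_derivative_sq_sub_one_pow hj (by norm_num)), ih (by omega),
      ← Function.iterate_succ_apply]
    ring

theorem integral_sq_sub_one_pow (n : ℕ) :
    ∫ x in (-1 : ℝ)..1, (x ^ 2 - 1) ^ n =
      (-1) ^ n * (2 ^ (2 * n + 1) * (n.factorial : ℝ) ^ 2 / ((2 * n + 1).factorial : ℝ)) := by
  induction n with
  | zero => norm_num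
  | succ n ih =>
    -- Integrating `d/dx (x (x ^ 2 - 1) ^ (n + 1))` gives the recurrence in `n`.
    have h0 : ∫ x in (-1 : ℝ)..1, ((2 * n + 3) * (x ^ 2 - 1) ^ (n + 1)
        + (2 * n + 2) * (x ^ 2 - 1) ^ n) = 0 := by
      rw [intervalIntegral.integral_eq_sub_of_hasDerivAt
        (f := fun x => x * (x ^ 2 - 1) ^ (n + 1))]
      · simp
      · intro x _
        refine ((hasDerivAt_id' x).fun_mul
          (((hasDerivAt_pow 2 x).sub_const 1).fun_pow (n + 1))).congr_deriv ?_
        simp only [Nat.add_sub_cancel]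
        push_cast
        ring
      · exact Continuous.intervalIntegrable (by fun_prop) _ _
    rw [intervalIntegral.integral_add (Continuous.intervalIntegrable (by fun_prop) _ _)
      (Continuous.intervalIntegrable (by fun_prop) _ _), intervalIntegral.integral_const_mul,
      intervalIntegral.integral_const_mul, ih] at h0
    have h3 : (2 * (n : ℝ) + 3) ≠ 0 := by positivity
    have h4 : ((2 * n + 1).factorial : ℝ) ≠ 0 := by positivity
    have h5 : ((2 * (n + 1) + 1).factorial : ℝ) =
        (2 * n + 3) * (2 * n + 2) * (2 * n + 1).factorial := by
      rw [show 2 * (n + 1) + 1 = (2 * n + 1) + 1 + 1 by ring, Nat.factorial_succ,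
        Nat.factorial_succ]
      push_cast
      ring
    apply mul_left_cancel₀ h3
    rw [eq_neg_of_add_eq_zero_left h0, h5, Nat.factorial_succ n]
    push_cast
    field_simp
    ring

theorem monic_sq_sub_one_pow (n : ℕ) : ((X ^ 2 - 1 : ℝ[X]) ^ n).Monic := by
  have h : (X ^ 2 - 1 : ℝ[X]).Monic := by simpa using monic_X_pow_sub_C (1 : ℝ) two_ne_zero
  exact h.pow n

theorem natDegree_sq_sub_one_pow (n : ℕ) : ((X ^ 2 - 1 : ℝ[X]) ^ n).natDegree = n + n := by
  have h : (X ^ 2 - 1 : ℝ[X]).natDegree = 2 := by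
    simpa using natDegree_X_pow_sub_C (n := 2) (r := (1 : ℝ))
  rw [natDegree_pow, h]
  ring

theorem natDegree_legendre_le (n : ℕ) : (legendre n).natDegree ≤ n := by
  refine (natDegree_C_mul_le _ _).trans ((natDegree_iterate_derivative _ _).trans ?_)
  rw [natDegree_sq_sub_one_pow]
  omega

theorem coeff_legendre_self (n : ℕ) :
    (legendre n).coeff n = (n + n).factorial / (2 ^ n * (n.factorial : ℝ) ^ 2) := by
  rw [legendre, coeff_C_mul, coeff_iterate_derivative, ← natDegree_sq_sub_one_pow n,
    (monic_sq_sub_one_pow n).coeff_natDegree, natDegree_sq_sub_one_pow, nsmul_eq_mul, mul_one,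
    Nat.descFactorial_eq_div (by omega), Nat.add_sub_cancel,
    Nat.cast_div (Nat.factorial_dvd_factorial (by omega)) (by positivity)]
  field_simp

theorem iterate_derivative_legendre_self (n : ℕ) :
    derivative^[n] (legendre n) = C ((n + n).factorial / (2 ^ n * (n.factorial : ℝ))) := by
  have hd : (derivative^[n] (legendre n)).natDegree ≤ 0 :=
    (natDegree_iterate_derivative _ _).trans (by have := natDegree_legendre_le n; omega)
  rw [eq_C_of_natDegree_le_zero hd, coeff_iterate_derivative, zero_add, coeff_legendre_self,
    Nat.descFactorial_self, nsmul_eq_mul]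
  congr 1
  field_simp

theorem integral_mul_legendre (n : ℕ) (q : ℝ[X]) :
    ∫ x in (-1 : ℝ)..1, q.eval x * (legendre n).eval x =
      1 / (2 ^ n * (n.factorial : ℝ)) *
        ((-1) ^ n * ∫ x in (-1 : ℝ)..1, (derivative^[n] q).eval x * (x ^ 2 - 1) ^ n) := by
  rw [← integral_mul_iterate_derivative_sq_sub_one_pow n le_rfl, ←
    intervalIntegral.integral_const_mul]
  refine intervalIntegral.integral_congr fun x _ => ?_
  simp only [legendre, eval_mul, eval_C]
  ring

theorem integral_legendre_mul_legendre_of_lt {m n : ℕ} (h : m < n) :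
    ∫ x in (-1 : ℝ)..1, (legendre m).eval x * (legendre n).eval x = 0 := by
  rw [integral_mul_legendre,
    iterate_derivative_eq_zero ((natDegree_legendre_le m).trans_lt h)]
  simp

theorem integral_legendre_mul_self (n : ℕ) :
    ∫ x in (-1 : ℝ)..1, (legendre n).eval x * (legendre n).eval x = 2 / (2 * n + 1) := by
  rw [integral_mul_legendre, iterate_derivative_legendre_self]
  simp only [eval_C]
  rw [intervalIntegral.integral_const_mul, integral_sq_sub_one_pow, Nat.factorial_succ, two_mul n]
  have h : ((-1 : ℝ)) ^ n * (-1) ^ n = 1 := by rw [← mul_pow]; simp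
  push_cast
  have h2 : ((n : ℝ) + n + 1) ≠ 0 := by positivity
  rw [show ∀ a b c : ℝ, a * ((-1) ^ n * (b * ((-1) ^ n * c))) = (-1) ^ n * (-1) ^ n * (a * b * c)
    by intros; ring, h, pow_succ, pow_add]
  field_simp
  ring

theorem integral_legendre_mul_legendre (m n : ℕ) :
    ∫ x in (-1 : ℝ)..1, (legendre m).eval x * (legendre n).eval x =
      if m = n then 2 / (2 * (n : ℝ) + 1) else 0 := by
  rcases lt_trichotomy m n with h | rfl | h
  · rw [if_neg h.ne, integral_legendre_mul_legendre_of_lt h]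
  · rw [if_pos rfl, integral_legendre_mul_self]
  · rw [if_neg h.ne']
    simp_rw [mul_comm ((legendre m).eval _)]
    exact integral_legendre_mul_legendre_of_lt h

theorem eval_legendreP (n : ℕ) (x : ℝ) :
    (legendreP n).eval x = √(2 * n + 1) * (legendre n).eval (x / Real.pi) := by
  simp [legendreP, div_eq_inv_mul]

/-- Orthonormality of the rescaled Legendre polynomials, written in the variable `ξ` with
`ω = -2 π ξ`. The sign is the one with which `P_n` appears in `chromaticMode`. -/
theorem integral_legendreP_mul_legendreP (m n : ℕ) :
    ∫ ξ in (-(1 / 2) : ℝ)..1 / 2, (legendreP m).eval (-(2 * Real.pi * ξ)) *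
      (legendreP n).eval (-(2 * Real.pi * ξ)) = if m = n then 1 else 0 := by
  have hx : ∀ ξ : ℝ, -(2 * Real.pi * ξ) / Real.pi = -2 * ξ := fun ξ => by
    field_simp
  simp only [eval_legendreP, hx]
  rw [intervalIntegral.integral_comp_mul_left (fun x => √(2 * m + 1) * (legendre m).eval x *
    (√(2 * n + 1) * (legendre n).eval x)) (by norm_num : (-2 : ℝ) ≠ 0)]
  rw [show (-2 : ℝ) * -(1 / 2) = 1 by norm_num, show (-2 : ℝ) * (1 / 2) = -1 by norm_num,
    intervalIntegral.integral_symm]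
  rw [intervalIntegral.integral_congr fun x _ => mul_mul_mul_comm (√(2 * m + 1))
    ((legendre m).eval x) (√(2 * n + 1)) ((legendre n).eval x),
    intervalIntegral.integral_const_mul, integral_legendre_mul_legendre]
  split_ifs with h
  · subst h
    rw [Real.mul_self_sqrt (by positivity)]
    field_simp
    norm_num
  · simp

theorem degree_legendreP (n : ℕ) : (legendreP n).degree = n := by
  have hc : (legendreP n).coeff n ≠ 0 := by
    rw [legendreP, coeff_C_mul, comp_C_mul_X_coeff, coeff_legendre_self]
    have := Real.pi_pos
    positivity
  have hd : (legendreP n).natDegree ≤ n := by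
    refine (natDegree_C_mul_le _ _).trans (natDegree_comp_le.trans ?_)
    calc _ ≤ n * 1 := Nat.mul_le_mul (natDegree_legendre_le n)
            ((natDegree_C_mul_le _ _).trans natDegree_X_le)
      _ = n := mul_one n
  rw [degree_eq_natDegree (fun h => hc (by simp [h])),
    natDegree_eq_of_le_of_coeff_ne_zero hd hc]

/-- A linear functional on polynomials is determined by its values on the Legendre polynomials. -/
theorem linearMap_ext_legendreP {M : Type*} [AddCommGroup M] [Module ℝ M] {φ ψ : ℝ[X] →ₗ[ℝ] M}
    (h : ∀ n, φ (legendreP n) = ψ (legendreP n)) : φ = ψ := by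
  let S : Polynomial.Sequence ℝ := ⟨legendreP, degree_legendreP⟩
  refine LinearMap.ext_on (S.span fun i => ?_) (s := Set.range S) ?_
  · exact (leadingCoeff_ne_zero.mpr (S.ne_zero i)).isUnit
  · rintro _ ⟨n, rfl⟩
    exact h n

/-! ### The Fourier integral on `L¹ ∩ L²` -/

/-- With the pairing `-innerₗ ℝ` the inverse Fourier integral becomes a `VectorFourier` integral. -/
theorem fourierInv_eq_fourierIntegral (g : ℝ → ℂ) :
    𝓕⁻ g = VectorFourier.fourierIntegral Real.fourierChar volume (-innerₗ ℝ) g := by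
  ext x
  simp [Real.fourierInv_eq, VectorFourier.fourierIntegral]

theorem continuous_fourierInv_of_integrable {g : ℝ → ℂ} (hg : Integrable g) :
    Continuous (𝓕⁻ g) := by
  rw [fourierInv_eq_fourierIntegral]
  exact VectorFourier.fourierIntegral_continuous Real.continuous_fourierChar
    (by simp; fun_prop) hg

open scoped SchwartzMap in
/-- On integrable functions the inverse Plancherel transform is given by the integral. Both sides
define the same tempered distribution: the left by definition of `𝓕⁻` on distributions, the right
by Fubini. -/
theorem coeFn_fourierInv_ae_eq {G : Lp ℂ 2 (volume : Measure ℝ)} (hG : Integrable G) :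
    (𝓕⁻ G : Lp ℂ 2 (volume : Measure ℝ)) =ᵐ[volume] 𝓕⁻ (G : ℝ → ℂ) := by
  have hflip (ψ : 𝓢(ℝ, ℂ)) : ∫ x, (𝓕⁻ ψ) x • G x = ∫ x, ψ x • 𝓕⁻ (G : ℝ → ℂ) x := by
    have hL : (-innerₗ ℝ).flip = -innerₗ ℝ := by
      ext
      simp
    have h := VectorFourier.integral_fourierIntegral_smul_eq_flip (L := -innerₗ ℝ)
      Real.continuous_fourierChar (by simp; fun_prop) (ψ.integrable (μ := volume)) hG
    rwa [hL, ← fourierInv_eq_fourierIntegral, ← fourierInv_eq_fourierIntegral,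
      ← SchwartzMap.fourierInv_coe] at h
  refine ae_eq_of_integral_contDiff_smul_eq
    ((Lp.memLp _).locallyIntegrable one_le_two)
    (continuous_fourierInv_of_integrable hG).locallyIntegrable fun g hg hc => ?_
  have hc' : HasCompactSupport (fun x => (g x : ℂ)) := hc.comp_left Complex.ofReal_zero
  let ψ : 𝓢(ℝ, ℂ) := hc'.toSchwartzMap (Complex.ofRealCLM.contDiff.comp hg)
  have h := congrArg (fun T => T ψ) (Lp.fourierInv_toTemperedDistribution_eq G)
  simp only [TemperedDistribution.fourierInv_apply, Lp.toTemperedDistribution_apply] at h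
  rw [hflip] at h
  exact h.symm

/-! ### Signals with spectrum in the band -/

/-- The frequency band `|ω| ≤ π`, in the variable `ξ = ω / (2 π)`. -/
abbrev band : Set ℝ := Set.Icc (-(1 / 2)) (1 / 2)

/-- The signal with spectrum `G` on the band and no other frequencies, as a function of time. -/
def bandSynthesis (G : ℝ → ℂ) : ℝ → ℂ := 𝓕⁻ (band.indicator G)

theorem bandSynthesis_apply (G : ℝ → ℂ) (t : ℝ) :
    bandSynthesis G t = ∫ ξ in band, Complex.exp (2 * Real.pi * Complex.I * ξ * t) * G ξ := by
  rw [bandSynthesis, Real.fourierInv_eq', ← integral_indicator measurableSet_Icc]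
  congr 1 with ξ
  by_cases h : ξ ∈ band
  · simp only [Set.indicator_of_mem h, smul_eq_mul]
    congr 2
    simp
    ring
  · simp only [Set.indicator_of_notMem h, smul_zero]

theorem integrableOn_continuous_mul {G h : ℝ → ℂ} (hG : IntegrableOn G band)
    (hh : Continuous h) : IntegrableOn (fun ξ => h ξ * G ξ) band :=
  hG.continuousOn_mul hh.continuousOn isCompact_Icc

theorem iteratedDeriv_bandSynthesis {G : ℝ → ℂ} (hG : IntegrableOn G band) (k : ℕ) :
    iteratedDeriv k (bandSynthesis G) =
      bandSynthesis fun ξ => (2 * Real.pi * Complex.I * ξ) ^ k * G ξ := by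
  ext t
  have hpow (n : ℕ) : Integrable (fun ξ : ℝ => ξ ^ n • band.indicator G ξ) := by
    have h := (integrable_indicator_iff measurableSet_Icc).mpr
      (integrableOn_continuous_mul hG (h := fun ξ => (ξ : ℂ) ^ n) (by fun_prop))
    refine h.congr (Filter.Eventually.of_forall fun ξ => ?_)
    by_cases hξ : ξ ∈ band <;> simp only [Set.indicator_of_mem, Set.indicator_of_notMem, hξ,
      not_false_eq_true, smul_zero, Complex.real_smul, Complex.ofReal_pow]
  -- Mathlib differentiates `𝓕`; the reflection `t ↦ -t` turns `𝓕⁻` into it.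
  have hneg : bandSynthesis G = fun t => 𝓕 (band.indicator G) (-t) := by
    ext t
    rw [bandSynthesis, Real.fourierInv_eq_fourier_neg]
  rw [hneg, iteratedDeriv_comp_neg, Real.iteratedDeriv_fourier (N := ⊤) (fun n _ => hpow n) le_top,
    ← Real.fourierInv_eq_fourier_neg, bandSynthesis_apply, Real.fourierInv_eq',
    ← integral_indicator measurableSet_Icc, ← integral_smul]
  congr 1 with ξ
  by_cases h : ξ ∈ band
  · simp only [Set.indicator_of_mem h, smul_eq_mul, Complex.real_smul]
    have : (-2 * Real.pi * Complex.I * ξ) ^ k = (-1) ^ k * (2 * Real.pi * Complex.I * ξ) ^ k := by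
      rw [← mul_pow]
      ring
    have h1 : ((-1 : ℂ)) ^ k * (-1) ^ k = 1 := by rw [← mul_pow]; simp
    rw [this]
    push_cast
    rw [show ∀ a b c : ℂ, (-1) ^ k * (a * ((-1) ^ k * b * c)) = (-1) ^ k * (-1) ^ k * (a * (b * c))
      by intros; ring, h1, one_mul]
    congr 2
    simp
    ring
  · simp only [Set.indicator_of_notMem h, smul_zero]

/-- A signal with spectrum in the band is the sum of its Taylor series, whose coefficients are the
moments of the spectrum. -/
theorem hasSum_bandSynthesis {G : ℝ → ℂ} (hG : IntegrableOn G band) (t : ℝ) :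
    HasSum (fun k : ℕ => (t : ℂ) ^ k / k.factorial * iteratedDeriv k (bandSynthesis G) 0)
      (bandSynthesis G t) := by
  let u (k : ℕ) (ξ : ℝ) : ℂ := (2 * Real.pi * Complex.I * ξ * t) ^ k / k.factorial * G ξ
  have hu (k : ℕ) : IntegrableOn (u k) band := integrableOn_continuous_mul hG (by fun_prop)
  have hbound (k : ℕ) : ∫ ξ in band, ‖u k ξ‖ ≤
      (Real.pi * |t|) ^ k / k.factorial * ∫ ξ in band, ‖G ξ‖ := by
    rw [← integral_const_mul]
    refine setIntegral_mono_on (hu k).norm (hG.norm.const_mul _) measurableSet_Icc fun ξ hξ => ?_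
    have hξ' : |ξ| ≤ 1 / 2 := abs_le.mpr hξ
    simp only [u, norm_mul, norm_div, norm_pow, Complex.norm_natCast, Complex.norm_real,
      Complex.norm_I, Complex.norm_ofNat, Real.norm_eq_abs, abs_of_pos Real.pi_pos]
    gcongr
    -- `2 π |ξ| ≤ π` on the band.
    nlinarith [Real.pi_pos]
  have hsum := hasSum_integral_of_summable_integral_norm hu
    (((Real.summable_pow_div_factorial (Real.pi * |t|)).mul_right _).of_nonneg_of_le
      (fun k => integral_nonneg fun ξ => norm_nonneg _) hbound)
  have hexp (ξ : ℝ) : ∑' k, u k ξ = Complex.exp (2 * Real.pi * Complex.I * ξ * t) * G ξ := by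
    simp only [u]
    rw [tsum_mul_right, Complex.exp_eq_exp_ℂ, NormedSpace.exp_eq_tsum_div]
  simp only [hexp] at hsum
  rw [← bandSynthesis_apply] at hsum
  refine hsum.congr_fun fun k => ?_
  rw [iteratedDeriv_bandSynthesis hG, bandSynthesis_apply, ← integral_const_mul]
  congr 1 with ξ
  simp [u, mul_pow]
  ring

/-- The signal with a square integrable spectrum `G` on the band is square integrable, with
Plancherel transform `G`. -/
theorem exists_memLp_bandSynthesis {G : ℝ → ℂ} (hG : MemLp G 2 (volume.restrict band)) :
    ∃ h : MemLp (bandSynthesis G) 2 volume,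
      (𝓕 (h.toLp (bandSynthesis G)) : Lp ℂ 2 (volume : Measure ℝ)) =ᵐ[volume]
        band.indicator G := by
  have hL : MemLp (band.indicator G) 2 volume :=
    (memLp_indicator_iff_restrict measurableSet_Icc).mpr hG
  have hI : Integrable (band.indicator G) :=
    (integrable_indicator_iff measurableSet_Icc).mpr (hG.integrable one_le_two)
  have hae := hL.coeFn_toLp
  have hfi : 𝓕⁻ (hL.toLp _ : ℝ → ℂ) = bandSynthesis G := by
    ext t
    rw [bandSynthesis, Real.fourierInv_eq, Real.fourierInv_eq]
    refine integral_congr_ae ?_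
    filter_upwards [hae] with ξ hξ
    rw [hξ]
  have h := coeFn_fourierInv_ae_eq (hI.congr hae.symm)
  rw [hfi] at h
  have hm : MemLp (bandSynthesis G) 2 volume := (memLp_congr_ae h).mp (Lp.memLp _)
  have heq : hm.toLp _ = (𝓕⁻ (hL.toLp (band.indicator G)) : Lp ℂ 2 (volume : Measure ℝ)) :=
    Lp.ext (hm.coeFn_toLp.trans h.symm)
  refine ⟨hm, ?_⟩
  rw [heq, FourierTransform.fourier_fourierInv_eq]
  exact hae

/-- Plancherel's theorem: a spectrum is determined by its signal. -/
theorem ae_eq_zero_of_bandSynthesis_eq_zero {G : ℝ → ℂ} (hG : MemLp G 2 (volume.restrict band))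
    (h : bandSynthesis G = 0) : G =ᵐ[volume.restrict band] 0 := by
  obtain ⟨hm, hF⟩ := exists_memLp_bandSynthesis hG
  have h0 : hm.toLp (bandSynthesis G) = 0 := by
    rw [Lp.eq_zero_iff_ae_eq_zero]
    filter_upwards [hm.coeFn_toLp] with x hx
    rw [hx, h]
  rw [h0, FourierTransform.fourier_zero] at hF
  rw [Filter.EventuallyEq, ae_restrict_iff' measurableSet_Icc]
  filter_upwards [hF, Lp.coeFn_zero ℂ 2 (volume : Measure ℝ)] with ξ h1 h2 hξ
  rw [h2, Set.indicator_of_mem hξ] at h1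
  exact h1.symm

/-- A continuous square integrable function whose Plancherel transform vanishes outside the band
is synthesized from its transform at every point. -/
theorem exists_eq_bandSynthesis {f : ℝ → ℂ} (hc : Continuous f) (hf : MemLp f 2 volume)
    (hs : ∀ᵐ ξ : ℝ, ξ ∉ band → (𝓕 (hf.toLp f) : Lp ℂ 2 (volume : Measure ℝ)) ξ = 0) :
    ∃ G : ℝ → ℂ, MemLp G 2 (volume.restrict band) ∧ f = bandSynthesis G := by
  set G : Lp ℂ 2 (volume : Measure ℝ) := 𝓕 (hf.toLp f) with hGdef
  have hG : MemLp G 2 (volume.restrict band) := (Lp.memLp G).restrict _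
  refine ⟨G, hG, ?_⟩
  have hind : (G : ℝ → ℂ) =ᵐ[volume] band.indicator G := by
    filter_upwards [hs] with ξ hξ
    by_cases h : ξ ∈ band
    · rw [Set.indicator_of_mem h]
    · rw [Set.indicator_of_notMem h, hξ h]
  obtain ⟨hm, hF⟩ := exists_memLp_bandSynthesis hG
  have h1 : (𝓕 (hm.toLp _) : Lp ℂ 2 (volume : Measure ℝ)) = 𝓕 (hf.toLp f) :=
    Lp.ext (hF.trans hind.symm)
  have h2 : hm.toLp _ = hf.toLp f := (Lp.fourierTransformₗᵢ ℝ ℂ).injective h1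
  have h3 : bandSynthesis G =ᵐ[volume] f := (MemLp.toLp_eq_toLp_iff _ _).mp h2
  have hcont : Continuous (bandSynthesis G) := continuous_fourierInv_of_integrable
    ((integrable_indicator_iff measurableSet_Icc).mpr (hG.integrable one_le_two))
  exact ((Continuous.ae_eq_iff_eq volume hcont hc).mp h3).symm

/-! ### Differential operators on the frequency side -/

/-- The real-linear functional on polynomials which sends `ω ^ k` to `i ^ k a k`. For
`a k = f^(k)(t)` this applies the operator `p(i d/dt)` to `f` at `t`. -/
def derivFunctional (a : ℕ → ℂ) : ℝ[X] →ₗ[ℝ] ℂ :=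
  Polynomial.lsum fun k => LinearMap.toSpanSingleton ℝ ℂ (Complex.I ^ k * a k)

theorem derivFunctional_apply (a : ℕ → ℂ) (p : ℝ[X]) :
    derivFunctional a p = p.sum fun k c => (c : ℂ) * Complex.I ^ k * a k := by
  simp [derivFunctional, Polynomial.lsum_apply, mul_assoc]

theorem derivFunctional_X_pow (a : ℕ → ℂ) (k : ℕ) :
    derivFunctional a (X ^ k) = Complex.I ^ k * a k := by
  rw [derivFunctional_apply, ← monomial_one_right_eq_X_pow, sum_monomial_index _ _ (by simp)]
  simp

/-- The chromatic derivatives determine the ordinary ones. -/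
theorem eq_of_derivFunctional_legendreP_eq {a b : ℕ → ℂ}
    (h : ∀ n, derivFunctional a (legendreP n) = derivFunctional b (legendreP n)) : a = b := by
  have hab := linearMap_ext_legendreP h
  ext k
  have hk := congrArg (fun φ => φ (X ^ k)) hab
  simp only [derivFunctional_X_pow] at hk
  exact mul_left_cancel₀ (pow_ne_zero k Complex.I_ne_zero) hk

/-- On the frequency side, `p(i d/dt)` is multiplication by `p(-ω)`. -/
theorem derivFunctional_bandSynthesis {G : ℝ → ℂ} (hG : IntegrableOn G band) (t : ℝ) (p : ℝ[X]) :
    derivFunctional (fun k => iteratedDeriv k (bandSynthesis G) t) p =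
      ∫ ξ in band, ((p.eval (-(2 * Real.pi * ξ)) : ℝ) : ℂ) *
        (Complex.exp (2 * Real.pi * Complex.I * ξ * t) * G ξ) := by
  have hint (k : ℕ) : IntegrableOn (fun ξ : ℝ => (p.coeff k : ℂ) * Complex.I ^ k *
      (Complex.exp (2 * Real.pi * Complex.I * ξ * t) *
        ((2 * Real.pi * Complex.I * ξ) ^ k * G ξ))) band := by
    have h := integrableOn_continuous_mul hG (h := fun ξ : ℝ => (p.coeff k : ℂ) * Complex.I ^ k *
      (Complex.exp (2 * Real.pi * Complex.I * ξ * t) * (2 * Real.pi * Complex.I * ξ) ^ k))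
      (by fun_prop)
    simpa only [mul_assoc] using h
  simp only [derivFunctional_apply, iteratedDeriv_bandSynthesis hG, bandSynthesis_apply,
    Polynomial.sum_def, ← integral_const_mul]
  rw [← integral_finsetSum _ fun k _ => hint k]
  congr 1 with ξ
  rw [eval_eq_sum, Polynomial.sum_def]
  push_cast
  rw [Finset.sum_mul]
  refine Finset.sum_congr rfl fun k _ => ?_
  have h : Complex.I ^ k * (2 * Real.pi * Complex.I * ξ) ^ k = (-(2 * Real.pi * ξ)) ^ k := by
    rw [← mul_pow]
    congr 1
    linear_combination 2 * Real.pi * ξ * Complex.I_mul_I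
  rw [← h]
  ring

/-! ### The Hilbert basis of chromatic modes -/

/-- The function `i^n P_n(-ω)`, whose inner product with the spectrum of a band-limited signal is
the `n`-th chromatic derivative of that signal at the origin. The inner product conjugates it, so it
carries `i^n` rather than `(-i)^n`. -/
def chromaticMode (n : ℕ) (ξ : ℝ) : ℂ :=
  Complex.I ^ n * ((legendreP n).eval (-(2 * Real.pi * ξ)) : ℝ)

theorem memLp_chromaticMode (n : ℕ) : MemLp (chromaticMode n) 2 (volume.restrict band) := by
  have hc : Continuous (chromaticMode n) := by
    unfold chromaticMode
    exact continuous_const.mul (Complex.continuous_ofReal.comp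
      ((legendreP n).continuous.comp (by fun_prop)))
  obtain ⟨C, hC⟩ := isCompact_Icc.exists_bound_of_continuousOn (s := band) hc.continuousOn
  exact MemLp.of_bound hc.aestronglyMeasurable C
    ((ae_restrict_iff' measurableSet_Icc).mpr (Filter.Eventually.of_forall hC))

/-- The `n`-th chromatic mode as an element of `L²` of the band. -/
def chromaticModeLp (n : ℕ) : Lp ℂ 2 (volume.restrict band) :=
  (memLp_chromaticMode n).toLp (chromaticMode n)

theorem inner_chromaticModeLp (n : ℕ) {g : ℝ → ℂ} (hg : MemLp g 2 (volume.restrict band)) :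
    inner ℂ (chromaticModeLp n) (hg.toLp g) =
      (-Complex.I) ^ n * ∫ ξ in band, ((legendreP n).eval (-(2 * Real.pi * ξ)) : ℝ) * g ξ := by
  rw [L2.inner_def, ← integral_const_mul]
  refine integral_congr_ae ?_
  filter_upwards [(memLp_chromaticMode n).coeFn_toLp, hg.coeFn_toLp] with ξ h1 h2
  rw [chromaticModeLp, h1, h2, RCLike.inner_apply, chromaticMode]
  simp only [map_mul, map_pow, Complex.conj_I, Complex.conj_ofReal]
  ring

theorem orthonormal_chromaticModeLp : Orthonormal ℂ chromaticModeLp := by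
  rw [orthonormal_iff_ite]
  intro m n
  have h : ∫ ξ in band, (((legendreP m).eval (-(2 * Real.pi * ξ)) : ℝ) : ℂ) *
      chromaticMode n ξ = Complex.I ^ n * if m = n then 1 else 0 := by
    rw [integral_Icc_eq_integral_Ioc, ← intervalIntegral.integral_of_le (by norm_num)]
    have h1 := congrArg (fun x : ℝ => (x : ℂ)) (integral_legendreP_mul_legendreP m n)
    simp only [← intervalIntegral.integral_ofReal] at h1
    simp only [chromaticMode, mul_left_comm _ (Complex.I ^ n)]
    rw [intervalIntegral.integral_const_mul]
    push_cast at h1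
    rw [h1]
    split_ifs <;> simp
  have h2 : inner ℂ (chromaticModeLp m) (chromaticModeLp n) =
      (-Complex.I) ^ m * (Complex.I ^ n * if m = n then 1 else 0) := by
    rw [← h]
    exact inner_chromaticModeLp m (memLp_chromaticMode n)
  rw [h2]
  split_ifs with hmn
  · subst hmn
    rw [mul_one, ← mul_pow]
    simp
  · simp

theorem norm_exp_two_pi_mul (ξ t : ℝ) :
    ‖Complex.exp (2 * Real.pi * Complex.I * ξ * t)‖ = 1 := by
  rw [← Complex.norm_exp_ofReal_mul_I (2 * Real.pi * ξ * t)]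
  push_cast
  ring_nf

theorem memLp_exp_mul {G : ℝ → ℂ} (hG : MemLp G 2 (volume.restrict band)) (t : ℝ) :
    MemLp (fun ξ : ℝ => Complex.exp (2 * Real.pi * Complex.I * ξ * t) * G ξ) 2
      (volume.restrict band) := by
  have hc : Continuous fun ξ : ℝ => Complex.exp (2 * Real.pi * Complex.I * ξ * t) := by fun_prop
  refine hG.of_le (hc.aestronglyMeasurable.mul hG.1) (Filter.Eventually.of_forall fun ξ => ?_)
  rw [norm_mul, norm_exp_two_pi_mul, one_mul]

theorem toLp_exp_mul_zero {G : ℝ → ℂ} (hG : MemLp G 2 (volume.restrict band)) :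
    (memLp_exp_mul hG 0).toLp _ = hG.toLp G := by
  simp

/-- The chromatic derivatives at `t` of a signal with spectrum `G` are the coordinates of the
modulated spectrum `exp(i ω t) G(ω)` in the system of chromatic modes. -/
theorem inner_chromaticModeLp_exp_mul {G : ℝ → ℂ} (hG : MemLp G 2 (volume.restrict band))
    (n : ℕ) (t : ℝ) :
    inner ℂ (chromaticModeLp n) ((memLp_exp_mul hG t).toLp _) = (-Complex.I) ^ n *
      derivFunctional (fun k => iteratedDeriv k (bandSynthesis G) t) (legendreP n) := by
  rw [inner_chromaticModeLp, derivFunctional_bandSynthesis (hG.integrable one_le_two)]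

/-- A spectrum orthogonal to all chromatic modes has a signal all of whose derivatives vanish at
the origin, so it is zero. -/
theorem span_chromaticModeLp_orthogonal : (Submodule.span ℂ (Set.range chromaticModeLp))ᗮ = ⊥ := by
  rw [Submodule.eq_bot_iff]
  intro g hg
  have hG : MemLp g 2 (volume.restrict band) := Lp.memLp g
  have hI : IntegrableOn g band := hG.integrable one_le_two
  have h0 (n : ℕ) : inner ℂ (chromaticModeLp n) g = 0 :=
    Submodule.inner_right_of_mem_orthogonal (Submodule.subset_span (Set.mem_range_self n)) hg
  have hexp : (memLp_exp_mul hG 0).toLp _ = g := by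
    exact (toLp_exp_mul_zero hG).trans (Lp.toLp_coeFn g hG)
  have hd : (fun k => iteratedDeriv k (bandSynthesis g) 0) = 0 := by
    refine eq_of_derivFunctional_legendreP_eq fun n => ?_
    have h := inner_chromaticModeLp_exp_mul hG n 0
    rw [hexp, h0] at h
    rw [(mul_eq_zero.mp h.symm).resolve_left (pow_ne_zero n (neg_ne_zero.mpr Complex.I_ne_zero))]
    simp [derivFunctional_apply, Polynomial.sum_def]
  have hz : bandSynthesis g = 0 := by
    ext t
    refine (hasSum_bandSynthesis hI t).unique ?_
    simp only [congrFun hd]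
    simp
  rw [Lp.eq_zero_iff_ae_eq_zero]
  exact ae_eq_zero_of_bandSynthesis_eq_zero hG hz

/-- The Hilbert basis of chromatic modes of `L²` of the band. -/
def chromaticBasis : HilbertBasis ℕ ℂ (Lp ℂ 2 (volume.restrict band)) :=
  HilbertBasis.mkOfOrthogonalEqBot orthonormal_chromaticModeLp span_chromaticModeLp_orthogonal

theorem chromaticBasis_repr_apply (g : Lp ℂ 2 (volume.restrict band)) (n : ℕ) :
    chromaticBasis.repr g n = inner ℂ (chromaticModeLp n) g := by
  rw [HilbertBasis.repr_apply_apply, chromaticBasis, HilbertBasis.coe_mkOfOrthogonalEqBot]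

/-- Parseval's identity. Modulation does not change the norm of the spectrum, which is why the sum
does not depend on `t`. -/
theorem hasSum_norm_sq_derivFunctional {G : ℝ → ℂ} (hG : MemLp G 2 (volume.restrict band))
    (t : ℝ) :
    HasSum (fun n => ‖(-Complex.I) ^ n *
        derivFunctional (fun k => iteratedDeriv k (bandSynthesis G) t) (legendreP n)‖ ^ 2)
      (∫ ξ in band, ‖G ξ‖ ^ 2) := by
  set g := (memLp_exp_mul hG t).toLp _ with hgdef
  have h := chromaticBasis.hasSum_inner_mul_inner g g
  have h2 := (RCLike.reCLM (K := ℂ)).hasSum h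
  have hnorm : ∫ ξ in band, ‖G ξ‖ ^ 2 = RCLike.re (inner ℂ g g) := by
    rw [L2.inner_def, ← integral_re]
    · refine integral_congr_ae ?_
      filter_upwards [(memLp_exp_mul hG t).coeFn_toLp] with ξ hξ
      rw [inner_self_eq_norm_sq, hgdef, hξ, norm_mul, norm_exp_two_pi_mul, one_mul]
    · exact L2.integrable_inner g g
  rw [hnorm]
  refine h2.congr_fun fun n => ?_
  rw [← inner_chromaticModeLp_exp_mul hG, ← hgdef, ← chromaticBasis_repr_apply]
  rw [HilbertBasis.repr_apply_apply, ← inner_conj_symm g, RCLike.conj_mul]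
  norm_cast

/-! ### Chromatic derivatives of entire functions -/

/-- On the real axis the derivatives of an entire function which is real there are those of its
restriction. -/
theorem ofReal_iteratedDeriv_eq {f : ℝ → ℝ} {F : ℂ → ℂ} (hF : Differentiable ℂ F)
    (hFf : ∀ t : ℝ, F (t : ℂ) = (f t : ℂ)) (k : ℕ) (t : ℝ) :
    ((iteratedDeriv k f t : ℝ) : ℂ) = iteratedDeriv k F t := by
  induction k generalizing t with
  | zero => simp [hFf]
  | succ k ih =>
    have hd : HasDerivAt (iteratedDeriv k F) (iteratedDeriv (k + 1) F t) (t : ℂ) := by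
      rw [iteratedDeriv_succ]
      exact ((hF.contDiff (n := ⊤)).differentiable_iteratedDeriv k (by simp) _).hasDerivAt
    have hre := hd.real_of_complex
    simp only [← ih, Complex.ofReal_re] at hre
    have hco := hd.comp_ofReal
    simp only [← ih] at hco
    rw [iteratedDeriv_succ, hre.deriv]
    exact (hre.ofReal_comp.unique hco)

theorem iteratedDeriv_comp_ofReal {F : ℂ → ℂ} (hF : Differentiable ℂ F) (k : ℕ) (t : ℝ) :
    iteratedDeriv k (fun x : ℝ => F x) t = iteratedDeriv k F t := by
  induction k generalizing t with
  | zero => simp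
  | succ k ih =>
    have hd : HasDerivAt (iteratedDeriv k F) (iteratedDeriv (k + 1) F t) (t : ℂ) := by
      rw [iteratedDeriv_succ]
      exact ((hF.contDiff (n := ⊤)).differentiable_iteratedDeriv k (by simp) _).hasDerivAt
    have hco := hd.comp_ofReal
    simp only [← ih] at hco
    rw [iteratedDeriv_succ, hco.deriv]

theorem chromaticDerivC_eq_derivFunctional (n : ℕ) (f : ℝ → ℝ) (t : ℝ) :
    chromaticDerivC n f t = (-Complex.I) ^ n *
      derivFunctional (fun k => ((iteratedDeriv k f t : ℝ) : ℂ)) (legendreP n) := by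
  rw [chromaticDerivC, derivFunctional_apply]

theorem chromaticDeriv_sq (n : ℕ) (f : ℝ → ℝ) (t : ℝ) :
    chromaticDeriv n f t ^ 2 = ‖chromaticDerivC n f t‖ ^ 2 := by
  rw [← ofReal_chromaticDeriv, Complex.norm_real, Real.norm_eq_abs, sq_abs]

/-- The numbers `K^n[f](0)`, if square summable, are the coordinates of a spectrum; its signal has
the same derivatives at the origin as `f`, so it is `f`. -/
theorem exists_eq_bandSynthesis_of_summable {f : ℝ → ℝ} {F : ℂ → ℂ} (hF : Differentiable ℂ F)
    (hFf : ∀ t : ℝ, F (t : ℂ) = (f t : ℂ))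
    (hs : Summable fun n => chromaticDeriv n f 0 ^ 2) :
    ∃ G : ℝ → ℂ, MemLp G 2 (volume.restrict band) ∧
      (fun t => (f t : ℂ)) = bandSynthesis G := by
  have hmem : Memℓp (fun n => chromaticDerivC n f 0) 2 := by
    rw [memℓp_gen_iff (by norm_num)]
    simpa [chromaticDeriv_sq] using hs
  let g : Lp ℂ 2 (volume.restrict band) := chromaticBasis.repr.symm ⟨_, hmem⟩
  have hG : MemLp g 2 (volume.restrict band) := Lp.memLp g
  have hexp : (memLp_exp_mul hG 0).toLp _ = g := by
    exact (toLp_exp_mul_zero hG).trans (Lp.toLp_coeFn g hG)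
  have hd : (fun k => iteratedDeriv k (bandSynthesis g) 0) =
      fun k => ((iteratedDeriv k f 0 : ℝ) : ℂ) := by
    refine eq_of_derivFunctional_legendreP_eq fun n => ?_
    apply mul_left_cancel₀ (pow_ne_zero n (neg_ne_zero.mpr Complex.I_ne_zero))
    rw [← inner_chromaticModeLp_exp_mul hG n 0, hexp, ← chromaticBasis_repr_apply,
      ← chromaticDerivC_eq_derivFunctional, LinearIsometryEquiv.apply_symm_apply]
  refine ⟨g, hG, ?_⟩
  ext t
  have h := Complex.hasSum_taylorSeries_of_entire hF 0 (t : ℂ)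
  rw [hFf] at h
  refine h.unique ((hasSum_bandSynthesis (hG.integrable one_le_two) t).congr_fun fun k => ?_)
  rw [congrFun hd k, ofReal_iteratedDeriv_eq hF hFf, smul_eq_mul, smul_eq_mul, sub_zero,
    Complex.ofReal_zero]
  ring

theorem hasSum_chromaticDeriv_sq {f : ℝ → ℝ} {F : ℂ → ℂ} (hF : Differentiable ℂ F)
    (hFf : ∀ t : ℝ, F (t : ℂ) = (f t : ℂ)) {G : ℝ → ℂ} (hG : MemLp G 2 (volume.restrict band))
    (hfG : (fun t => (f t : ℂ)) = bandSynthesis G) (t : ℝ) :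
    HasSum (fun n => chromaticDeriv n f t ^ 2) (∫ ξ in band, ‖G ξ‖ ^ 2) := by
  refine (hasSum_norm_sq_derivFunctional hG t).congr_fun fun n => ?_
  rw [chromaticDeriv_sq, chromaticDerivC_eq_derivFunctional, ← hfG]
  simp only [ofReal_iteratedDeriv_eq hF hFf, ← hFf, iteratedDeriv_comp_ofReal hF]

theorem notMem_Icc_pi_iff (ξ : ℝ) :
    2 * Real.pi * ξ ∉ Set.Icc (-Real.pi) Real.pi ↔ ξ ∉ band := by
  rw [not_iff_not, Set.mem_Icc, Set.mem_Icc]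
  have := Real.pi_pos
  constructor <;> rintro ⟨h1, h2⟩ <;> constructor <;> nlinarith

end

theorem mainTheorem1 (f : ℝ → ℝ)
    (hf : ∃ F : ℂ → ℂ, Differentiable ℂ F ∧ ∀ t : ℝ, F (t : ℂ) = (f t : ℂ)) :
    List.TFAE
      [ Summable (fun n : ℕ => chromaticDeriv n f 0 ^ 2),
        ∃ c : ℝ, ∀ t : ℝ, HasSum (fun n : ℕ => chromaticDeriv n f t ^ 2) c,
        f ∈ BL Real.pi ] := by
  obtain ⟨F, hF, hFf⟩ := hf
  have hc : Continuous fun t => (f t : ℂ) := by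
    simp only [← hFf]
    exact hF.continuous.comp Complex.continuous_ofReal
  tfae_have 2 → 1 := fun ⟨c, h⟩ => (h 0).summable
  tfae_have 1 → 3 := by
    intro h
    obtain ⟨G, hG, hfG⟩ := exists_eq_bandSynthesis_of_summable hF hFf h
    have hL := exists_memLp_bandSynthesis hG
    rw [← hfG] at hL
    obtain ⟨hm, hFm⟩ := hL
    refine ⟨Complex.continuous_re.comp hc, hm, ?_⟩
    filter_upwards [hFm] with ξ hξ hn
    rw [hξ, Set.indicator_of_notMem ((notMem_Icc_pi_iff ξ).mp hn)]
  tfae_have 3 → 2 := by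
    rintro ⟨-, hm, hs⟩
    obtain ⟨G, hG, hfG⟩ := exists_eq_bandSynthesis hc hm
      (hs.mono fun ξ h hn => h ((notMem_Icc_pi_iff ξ).mpr hn))
    exact ⟨_, hasSum_chromaticDeriv_sq hF hFf hG hfG⟩
  tfae_finish
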